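/- Let $p$ be a prime number, let $k$ be a positive integer, and let $F$ be a group isomorphic to $\mathrm{PSL}_2(\mathbf{F}_{p^k})$ or to $\mathrm{PGL}_2(\mathbf{F}_{p^k})$. Let $\bar H$ be a finite cyclic group of order coprime to $p$, and let $H$ be a group which fits into an exact sequence $$1\to F\to H\to \bar H\to 1,$$ so that $F$ is regarded as a normal subgroup of $H$. Suppose that for every element $\lambda\in F$ of order coprime to $p$, and every element $\alpha\in H$ which normalizes the cyclic group generated by $\lambda$, the element $\alpha^2$ commutes with $\lambda$. Then $H$ contains a cyclic subgroup $A$ of order coprime to $p$ and index at most $2\cdot|F_{(p)}|^3$, where $F_{(p)}$ denotes a Sylow $p$-subgroup of $F$, such that $A$ is preserved by $\mathrm{Aut}(H;F)$, i.e. $\varphi(A)=A$ for every automorphism $\varphi$ of $H$ with $\varphi(F)=F$. -/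

import Mathlib

/-- The projective general linear group `PGL_n(R)`: the quotient of `GL_n(R)` by its center
(over a field, the center consists of the nonzero scalar matrices). -/
abbrev ProjectiveGeneralLinearGroup (n : Type*) [DecidableEq n] [Fintype n]
    (R : Type*) [CommRing R] : Type _ :=
  Matrix.GeneralLinearGroup n R ⧸ Subgroup.center (Matrix.GeneralLinearGroup n R)

/-- `Aut(G; N)`: the group of automorphisms of `G` that map the subgroup `N` onto itself. -/
def autPreserving {G : Type*} [Group G] (N : Subgroup G) : Subgroup (MulAut G) where
  carrier := {φ | N.map φ.toMonoidHom = N}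
  one_mem' := by
    ext x
    simp
  mul_mem' := by
    intro φ ψ hφ hψ
    have h : N.map (φ * ψ).toMonoidHom = (N.map ψ.toMonoidHom).map φ.toMonoidHom := by
      rw [Subgroup.map_map]
      rfl
    change N.map (φ * ψ).toMonoidHom = N
    rw [h, hψ, hφ]
  inv_mem' := by
    intro φ hφ
    change N.map (φ⁻¹).toMonoidHom = N
    have h : (N.map φ.toMonoidHom).map (φ⁻¹).toMonoidHom = N := by
      rw [Subgroup.map_map]
      ext x
      simp
    rw [hφ] at h
    exact h

/-! Take `A` to be the centralizer of `F` in `H`, the kernel of conjugation `H → Aut F`. It is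
determined by the pair `(H, F)`, hence preserved. As `F` has trivial center, `A` meets `F` trivially
and embeds in `Hbar`, so it is cyclic of order prime to `p`. Its index is the order of the image `Γ`
of `H` in `Aut F`.

To bound `Γ`, let `q = p ^ k` be the order of a Sylow `p`-subgroup. The Sylow `p`-subgroups of `F`
are the `q + 1` points of the projective line. In `Γ`, fix successively a Sylow subgroup `P`, a
second one `Q`, a generator `t` of the torus fixing both, and some `u ≠ 1` in `P`; the orbits have
at most `q + 1`, `q`, `2` and `q - 1` elements. The `2` comes from the hypothesis on `α ^ 2`, since
`Γ` is cyclic modulo inner automorphisms. What fixes all four is trivial: the torus conjugates of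
`u` generate `P`, because every element of a finite field is a difference of two squares. Finally `2
* q * (q ^ 2 - 1) ≤ 2 * q ^ 3` (`card_subgroup_mulAut_le`). -/

/-! ### Bounding automorphism groups through the action on Sylow subgroups -/

section AutomorphismBound

open MulAction Pointwise

theorem relIndex_inf_stabilizer {G X : Type*} [Group G] [MulAction G X] (S : Subgroup G) (x : X) :
    (S ⊓ stabilizer G x).relIndex S = (orbit S x).ncard := by
  rw [Subgroup.inf_relIndex_left, ← MulAction.index_stabilizer, Subgroup.relIndex]
  congr 1

/-- If every element of `S` acts on `x` as some power of `g`, and `g ^ 2` fixes `x`, then the orbit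
of `x` has at most two elements. -/
theorem ncard_orbit_le_two {G X : Type*} [Group G] [MulAction G X] (S : Subgroup G) (x : X) (g : G)
    (hg : g ^ 2 ∈ stabilizer G x) (hS : ∀ s ∈ S, ∃ n : ℤ, s • x = g ^ n • x) :
    (orbit S x).ncard ≤ 2 := by
  have hsub : orbit S x ⊆ {x, g • x} := by
    rintro _ ⟨⟨s, hs⟩, rfl⟩
    obtain ⟨n, hn⟩ := hS s hs
    change s • x ∈ _
    rw [hn]
    have key (m : ℤ) : g ^ (2 * m) • x = x := by
      rw [zpow_mul]
      exact mem_stabilizer_iff.1 (zpow_mem (by exact_mod_cast hg) m)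
    obtain ⟨m, rfl | rfl⟩ := Int.even_or_odd' n
    · simp [key]
    · right
      rw [add_comm, zpow_add, zpow_one, mul_smul, key]
      rfl
  exact (Set.ncard_le_ncard hsub (Set.toFinite _)).trans 
    ((Set.ncard_insert_le _ _).trans (by simp))

variable {F : Type*} [Group F] {p : ℕ}

theorem card_sylow_ne_le [Finite F] (P Q : Sylow p F)
    (h : ∀ R : Sylow p F, R ≠ P → ∃ u ∈ P, u • Q = R) :
    ({P}ᶜ : Set (Sylow p F)).ncard ≤ Nat.card P := by
  have hsub : ({P}ᶜ : Set (Sylow p F)) ⊆ Set.range (fun u : P ↦ (u : F) • Q) := by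
    intro R hR
    obtain ⟨u, hu, rfl⟩ := h R hR
    exact ⟨⟨u, hu⟩, rfl⟩
  refine (Set.ncard_le_ncard hsub (Set.toFinite _)).trans ?_
  rw [← Set.image_univ, ← Set.ncard_univ P]
  exact Set.ncard_image_le (Set.toFinite _)

theorem MulAut.smul_sylow_smul (α : MulAut F) (f : F) (R : Sylow p F) :
    α • f • R = α f • α • R := by
  rw [Sylow.smul_def, Sylow.smul_def, smul_smul, smul_smul]
  congr 1
  ext x
  simp

/-- An automorphism of `F` that centralizes the Sylow subgroup `P` and normalizes `Q` is trivial,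
if `P` permutes the Sylow subgroups other than `P` transitively
and `F` acts faithfully on its Sylow subgroups. -/
theorem MulAut.eq_one_of_fixes_sylow (P Q : Sylow p F)
    (htrans : ∀ R : Sylow p F, R ≠ P → ∃ u ∈ P, u • Q = R)
    (hfaith : ∀ f : F, (∀ R : Sylow p F, f • R = R) → f = 1)
    (α : MulAut F) (hP : ∀ u ∈ P, α u = u) (hQ : α • Q = Q) : α = 1 := by
  have hfix (R : Sylow p F) : α • R = R := by
    by_cases hR : R = P
    · subst hR
      refine Sylow.ext (SetLike.ext' ?_)
      change (fun x ↦ α x) '' (R : Set F) = R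
      rw [Set.image_congr (g := id) hP, Set.image_id]
    · obtain ⟨u, hu, rfl⟩ := htrans R hR
      rw [smul_sylow_smul, hP u hu, hQ]
  ext f
  have := hfaith (α f * f⁻¹) fun R ↦ by
    have h := smul_sylow_smul α f (f⁻¹ • R)
    rw [smul_inv_smul, hfix, hfix, smul_smul] at h
    exact h.symm
  exact mul_inv_eq_one.1 this

/-- A bound on a group `Γ` of automorphisms of a finite group `F` whose Sylow `p`-subgroups are
permuted as the points of a projective line. The element `t` generates the
stabilizer of the pair `P, Q`, and `P` is generated by the `t`-conjugates of `u`. -/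
theorem card_subgroup_mulAut_le [Finite F] (P Q : Sylow p F) (hPQ : Q ≠ P)
    (htrans : ∀ R : Sylow p F, R ≠ P → ∃ u ∈ P, u • Q = R)
    (hfaith : ∀ f : F, (∀ R : Sylow p F, f • R = R) → f = 1)
    (t : F) (ht : ∀ f : F, f ∈ Subgroup.zpowers t ↔ f • P = P ∧ f • Q = Q)
    (u : F) (hu : u ∈ P) (hu1 : u ≠ 1)
    (hgen : (P : Subgroup F) ≤ Subgroup.closure (Set.range fun n : ℤ ↦ t ^ n * u * (t ^ n)⁻¹))
    (Γ : Subgroup (MulAut F))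
    (hcyc : ∀ S ≤ Γ, ∃ s ∈ S, ∀ x ∈ S, ∃ (n : ℤ) (f : F), x = s ^ n * MulAut.conj f)
    (hsq : ∀ α ∈ Γ, (∀ f, α f ∈ Subgroup.zpowers t ↔ f ∈ Subgroup.zpowers t) → α (α t) = t) :
    Nat.card Γ ≤ 2 * Nat.card P ^ 3 := by
  set q := Nat.card P with hq
  have hq1 : 1 ≤ q := Nat.card_pos
  set S₁ := Γ ⊓ stabilizer (MulAut F) P with hS₁
  set S₂ := S₁ ⊓ stabilizer (MulAut F) Q with hS₂
  set S₃ := S₂ ⊓ stabilizer (MulAut F) t with hS₃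
  have hcard := card_sylow_ne_le P Q htrans
  have h₁ : S₁.relIndex Γ ≤ q + 1 := by
    rw [relIndex_inf_stabilizer]
    refine (Set.ncard_le_card _).trans ?_
    have := Set.ncard_add_ncard_compl ({P} : Set (Sylow p F))
    rw [Set.ncard_singleton] at this
    omega
  have h₂ : S₂.relIndex S₁ ≤ q := by
    rw [relIndex_inf_stabilizer]
    refine (Set.ncard_le_ncard ?_ (Set.toFinite _)).trans hcard
    rintro _ ⟨⟨s, hs⟩, rfl⟩ h
    change s • Q = P at h
    have hP : s • P = P := hs.2
    exact hPQ (smul_left_cancel s (h.trans hP.symm))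
  -- Fixing `P` and `Q`, `α` preserves their joint stabilizer in `F`, which is the torus.
  have hnorm (α : MulAut F) (hα : α ∈ S₂) (f : F) :
      α f ∈ Subgroup.zpowers t ↔ f ∈ Subgroup.zpowers t := by
    have key (R : Sylow p F) (hR : α • R = R) : α f • R = R ↔ f • R = R := by
      have h := MulAut.smul_sylow_smul α f R
      rw [hR] at h
      rw [← h]
      exact ⟨fun h' ↦ smul_left_cancel α (h'.trans hR.symm), fun h' ↦ by rw [h', hR]⟩
    rw [ht, ht, key P hα.1.2, key Q hα.2]
  have h₃ : S₃.relIndex S₂ ≤ 2 := by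
    rw [relIndex_inf_stabilizer]
    obtain ⟨s, hs, hgen⟩ := hcyc S₂ (inf_le_left.trans inf_le_left)
    refine ncard_orbit_le_two S₂ t s ?_ fun x hx ↦ ?_
    · rw [mem_stabilizer_iff, pow_two, mul_smul]
      exact hsq s hs.1.1 (hnorm s hs)
    · obtain ⟨n, f, rfl⟩ := hgen x hx
      refine ⟨n, ?_⟩
      -- The inner part also fixes `P` and `Q`, so `f` lies in the torus and commutes with `t`.
      have hf : MulAut.conj f ∈ S₂ := by
        simpa using mul_mem (inv_mem (zpow_mem hs n)) hx
      have hft : f ∈ Subgroup.zpowers t := (ht f).2 ⟨hf.1.2, hf.2⟩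
      rw [mul_smul]
      congr 1
      obtain ⟨m, rfl⟩ := hft
      change t ^ m * t * (t ^ m)⁻¹ = t
      rw [mul_inv_eq_iff_eq_mul]
      exact Commute.zpow_self t m
  have hbot : S₃ ⊓ stabilizer (MulAut F) u = ⊥ := by
    rw [eq_bot_iff]
    rintro α ⟨⟨hα, hαt⟩, hαu⟩
    replace hαt : α t = t := hαt
    replace hαu : α u = u := hαu
    refine MulAut.eq_one_of_fixes_sylow P Q htrans hfaith α (fun x hx ↦ ?_) hα.2
    refine Subgroup.closure_induction (p := fun y _ ↦ α y = y) ?_ (map_one α) ?_ ?_ (hgen hx)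
    · rintro _ ⟨n, rfl⟩
      simp [hαt, hαu]
    · intro a b _ _ ha hb
      rw [map_mul, ha, hb]
    · intro a _ ha
      rw [map_inv, ha]
  have h₄ : (⊥ : Subgroup (MulAut F)).relIndex S₃ ≤ q - 1 := by
    rw [← hbot, relIndex_inf_stabilizer]
    have hsub : orbit S₃ u ⊆ (P : Set F) \ {1} := by
      rintro _ ⟨⟨s, hs⟩, rfl⟩
      have hP : s • P = P := hs.1.1.2
      refine ⟨?_, ?_⟩
      · have : s u ∈ s • P := ⟨u, hu, rfl⟩
        rwa [hP] at this
      · change ¬ s u = 1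
        simpa using hu1
    refine (Set.ncard_le_ncard hsub (Set.toFinite _)).trans ?_
    rw [Set.ncard_sdiff_singleton_of_mem (one_mem P)]
    rfl
  have hchain : Nat.card Γ = (⊥ : Subgroup (MulAut F)).relIndex S₃ * S₃.relIndex S₂ *
      S₂.relIndex S₁ * S₁.relIndex Γ := by
    rw [Subgroup.relIndex_mul_relIndex _ _ _ bot_le inf_le_left,
      Subgroup.relIndex_mul_relIndex _ _ _ bot_le inf_le_left,
      Subgroup.relIndex_mul_relIndex _ _ _ bot_le inf_le_left, Subgroup.relIndex_bot_left]
  rw [hchain]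
  calc _ ≤ (q - 1) * 2 * q * (q + 1) := by gcongr
    _ ≤ 2 * q ^ 3 := by
      obtain ⟨r, hr⟩ := Nat.exists_eq_add_of_le' hq1
      rw [hr, Nat.add_sub_cancel]
      nlinarith [sq_nonneg r]

end AutomorphismBound

/-! ### Conjugation action of an extension on its kernel -/

namespace GroupExtension

variable {F H C : Type*} [Group F] [Group H] [Group C] (E : GroupExtension F H C)

theorem ker_conjAct : E.conjAct.ker = Subgroup.centralizer (E.inl.range : Set H) := by
  ext h
  rw [MonoidHom.mem_ker, Subgroup.mem_centralizer_iff]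
  constructor
  · rintro hh _ ⟨f, rfl⟩
    have := E.inl_conjAct_comm (e := h) (n := f)
    rw [hh, MulAut.one_apply] at this
    rw [eq_mul_inv_iff_mul_eq.1 this]
  · intro hh
    ext f
    apply E.inl_injective
    rw [inl_conjAct_comm, ← hh _ ⟨f, rfl⟩, mul_inv_cancel_right, MulAut.one_apply]

theorem conjAct_inl (f : F) : E.conjAct (E.inl f) = MulAut.conj f := by
  ext x
  apply E.inl_injective
  rw [inl_conjAct_comm, MulAut.conj_apply]
  simp

/-- An element of `F` acting trivially on `F` is central in `F`. -/
theorem injective_rightHom_ker_conjAct (hF : Subgroup.center F = ⊥) :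
    Function.Injective (E.rightHom.comp E.conjAct.ker.subtype) := by
  rw [injective_iff_map_eq_one]
  rintro ⟨h, hh⟩ h1
  change E.rightHom h = 1 at h1
  rw [← MonoidHom.mem_ker, ← E.range_inl_eq_ker_rightHom] at h1
  obtain ⟨f, rfl⟩ := h1
  rw [MonoidHom.mem_ker, conjAct_inl] at hh
  have hf : f ∈ Subgroup.center F := Subgroup.mem_center_iff.2 fun g ↦ by
    have := DFunLike.congr_fun hh g
    rw [MulAut.conj_apply, MulAut.one_apply, mul_inv_eq_iff_eq_mul] at this
    exact this.symm
  rw [hF, Subgroup.mem_bot] at hf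
  simp [hf]

/-- The preimage of `S` in `H` has cyclic image in `C`, and elements of `H` with equal image in `C`
differ by an element of `F`, which acts as an inner automorphism. -/
theorem exists_generator_mod_conj [IsCyclic C] (S : Subgroup (MulAut F))
    (hS : S ≤ E.conjAct.range) :
    ∃ s ∈ S, ∀ x ∈ S, ∃ (n : ℤ) (f : F), x = s ^ n * MulAut.conj f := by
  obtain ⟨⟨_, a, ha, rfl⟩, hgen⟩ :=
    IsCyclic.exists_generator (α := (S.comap E.conjAct).map E.rightHom)
  refine ⟨E.conjAct a, ha, fun x hx ↦ ?_⟩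
  obtain ⟨b, rfl⟩ := hS hx
  obtain ⟨n, hn⟩ := hgen ⟨E.rightHom b, b, hx, rfl⟩
  replace hn : E.rightHom a ^ n = E.rightHom b := congrArg Subtype.val hn
  have : (a ^ n)⁻¹ * b ∈ E.inl.range := by
    rw [E.range_inl_eq_ker_rightHom, MonoidHom.mem_ker, map_mul, map_inv, map_zpow, hn,
      inv_mul_cancel]
  obtain ⟨f, hf⟩ := this
  refine ⟨n, f, ?_⟩
  rw [← E.conjAct_inl, hf]
  simp

theorem conjAct_sq_apply (t : F)
    (hE : ∀ a : H, a ∈ Subgroup.normalizer (Subgroup.zpowers (E.inl t) : Set H) →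
      Commute (a ^ 2) (E.inl t))
    (α : MulAut F) (hα : α ∈ E.conjAct.range)
    (h : ∀ f, α f ∈ Subgroup.zpowers t ↔ f ∈ Subgroup.zpowers t) : α (α t) = t := by
  obtain ⟨a, rfl⟩ := hα
  have hz (f : F) : E.inl f ∈ Subgroup.zpowers (E.inl t) ↔ f ∈ Subgroup.zpowers t := by
    rw [← MonoidHom.map_zpowers E.inl t, Subgroup.mem_map_iff_mem E.inl_injective]
  have hr (x : H) (hx : x ∈ Subgroup.zpowers (E.inl t)) : x ∈ E.inl.range := by
    obtain ⟨n, rfl⟩ := hx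
    exact ⟨t ^ n, map_zpow _ _ _⟩
  have ha := hE a <| Subgroup.mem_normalizer_iff.2 fun x ↦ by
    constructor
    · intro hx
      obtain ⟨f, rfl⟩ := hr x hx
      rw [← inl_conjAct_comm, hz, h]
      exact (hz f).1 hx
    · intro hx
      obtain ⟨g, hg⟩ := hr _ hx
      have hx' : x = E.inl (E.conjAct a⁻¹ g) := by
        rw [inl_conjAct_comm, hg]
        group
      rw [hx', hz, ← h, ← MulAut.mul_apply, ← map_mul, mul_inv_cancel, map_one, MulAut.one_apply,
        ← hz, hg]
      exact hx
  apply E.inl_injective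
  rw [← MulAut.mul_apply, ← map_mul, inl_conjAct_comm, ← pow_two, ha.eq, mul_inv_cancel_right]

theorem map_centralizer_range_inl (φ : MulAut H) (hφ : φ ∈ autPreserving E.inl.range) :
    (Subgroup.centralizer (E.inl.range : Set H)).map φ.toMonoidHom =
      Subgroup.centralizer (E.inl.range : Set H) := by
  have hle : ∀ φ ∈ autPreserving E.inl.range,
      (Subgroup.centralizer (E.inl.range : Set H)).map φ.toMonoidHom ≤
        Subgroup.centralizer (E.inl.range : Set H) := by
    rintro φ hφ _ ⟨x, hx, rfl⟩
    replace hφ : E.inl.range.map φ.toMonoidHom = E.inl.range := hφ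
    rw [Subgroup.mem_centralizer_iff]
    intro y hy
    rw [SetLike.mem_coe, ← hφ] at hy
    obtain ⟨z, hz, rfl⟩ := hy
    rw [← map_mul, ← map_mul, Subgroup.mem_centralizer_iff.1 hx z hz]
  refine le_antisymm (hle φ hφ) fun x hx ↦ ?_
  exact ⟨φ⁻¹ x, hle φ⁻¹ (inv_mem hφ) ⟨x, hx, rfl⟩, φ.apply_symm_apply x⟩

end GroupExtension

/-! ### Root groups, tori and Sylow subgroups of `PSL₂` and `PGL₂` -/

section LinearGroups

open MulAction Matrix
open scoped MatrixGroups

theorem FiniteField.exists_sq_sub_sq {K : Type*} [Field K] [Finite K] (x : K) :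
    ∃ a b : K, x = a ^ 2 - b ^ 2 := by
  by_cases h2 : ringChar K = 2
  · obtain ⟨a, ha⟩ := FiniteField.isSquare_of_char_two h2 x
    exact ⟨a, 0, by rw [ha]; ring⟩
  · have : (2 : K) ≠ 0 := Ring.two_ne_zero h2
    exact ⟨(x + 1) / 2, (x - 1) / 2, by field_simp; ring⟩

namespace TwoByTwo

variable {K : Type*} [Field K]

/-- The upper unitriangular matrices. -/
def unipotent : Multiplicative K →* SL(2, K) where
  toFun x := ⟨!![1, x.toAdd; 0, 1], by simp⟩
  map_one' := Subtype.ext one_fin_two.symm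
  map_mul' x y := Subtype.ext <| by
    change _ = !![1, x.toAdd; 0, 1] * !![1, y.toAdd; 0, 1]
    simp [add_comm]

/-- The Weyl element. -/
def weyl : SL(2, K) := ⟨!![0, -1; 1, 0], by simp⟩

/-- The diagonal matrices of determinant one. -/
def torus (r : Kˣ) : SL(2, K) := ⟨!![(r : K), 0; 0, (r⁻¹ : Kˣ)], by simp⟩

/-- The diagonal matrices. -/
def diag : Kˣ × Kˣ →* GL (Fin 2) K where
  toFun x := ⟨!![(x.1 : K), 0; 0, x.2], !![((x.1⁻¹ : Kˣ) : K), 0; 0, (x.2⁻¹ : Kˣ)],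
    by simp [one_fin_two], by simp [one_fin_two]⟩
  map_one' := by
    ext i j
    fin_cases i <;> fin_cases j <;> simp
  map_mul' x y := by
    ext i j
    fin_cases i <;> fin_cases j <;> simp [Matrix.mul_apply, Fin.sum_univ_two]

theorem coe_unipotent (x : Multiplicative K) :
    (unipotent x : Matrix (Fin 2) (Fin 2) K) = !![1, x.toAdd; 0, 1] := rfl

theorem coe_weyl : (weyl : SL(2, K)).val = !![0, -1; 1, 0] := rfl

theorem coe_torus (r : Kˣ) : (torus r).val = !![(r : K), 0; 0, (r⁻¹ : Kˣ)] := rfl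

/-- Only squares arise as torus conjugates of the unit root element in `SL₂`;
`FiniteField.exists_sq_sub_sq` recovers the rest of the root group. -/
theorem torus_mul_unipotent_one (r : Kˣ) :
    torus r * unipotent (.ofAdd 1) = unipotent (.ofAdd ((r : K) ^ 2)) * torus r := by
  refine Matrix.SpecialLinearGroup.ext _ _ fun i j ↦ ?_
  rw [Matrix.SpecialLinearGroup.coe_mul, Matrix.SpecialLinearGroup.coe_mul, coe_torus,
    coe_unipotent, coe_unipotent]
  fin_cases i <;> fin_cases j <;> simp [pow_two]

theorem mem_center_iff (g : GL (Fin 2) K) :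
    g ∈ Subgroup.center (GL (Fin 2) K) ↔ g 1 0 = 0 ∧ g 0 1 = 0 ∧ g 0 0 = g 1 1 := by
  rw [GeneralLinearGroup.mem_center_iff_val_mem_range_scalar]
  constructor
  · rintro ⟨r, hr⟩
    simp [← hr]
  · rintro ⟨h1, h2, h3⟩
    refine ⟨g 0 0, ?_⟩
    ext i j
    fin_cases i <;> fin_cases j <;> simp [h1, h2, h3]

theorem exists_eq_diag (g : GL (Fin 2) K) (h1 : g 1 0 = 0) (h2 : g 0 1 = 0) :
    ∃ x, g = diag x := by
  have hdet : g 0 0 * g 1 1 ≠ 0 := by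
    have := g.det.ne_zero
    rw [GeneralLinearGroup.val_det_apply, det_fin_two, h1] at this
    simpa using this
  refine ⟨(Units.mk0 _ (left_ne_zero_of_mul hdet), Units.mk0 _ (right_ne_zero_of_mul hdet)), ?_⟩
  ext i j
  fin_cases i <;> fin_cases j <;> simp [diag, h1, h2]

theorem diag_mem_center (x : Kˣ × Kˣ) (hx : x.1 / x.2 = 1) :
    diag x ∈ Subgroup.center (GL (Fin 2) K) := by
  rw [mem_center_iff]
  simp [diag, div_eq_one.1 hx]

/-- A group `F` between `PSL₂(K)` and `PGL₂(K)`, as the quotient by its scalar matrices of a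
group `G` between `SL₂(K)` and `GL₂(K)`. -/
structure ProjectiveCover (K G F : Type*) [Field K] [Group G] [Group F] where
  /-- The inclusion of the special linear group. -/
  ofSL : SL(2, K) →* G
  /-- The inclusion into the general linear group. -/
  toGL : G →* GL (Fin 2) K
  /-- The projection. -/
  proj : G →* F
  toGL_injective : Function.Injective toGL
  toGL_ofSL : ∀ A, toGL (ofSL A) = SpecialLinearGroup.toGL A
  proj_surjective : Function.Surjective proj
  proj_eq_one_iff : ∀ g, proj g = 1 ↔ toGL g ∈ Subgroup.center (GL (Fin 2) K)

/-- `PSL₂` is covered by `SL₂`. -/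
def ProjectiveCover.psl {F : Type*} [Group F]
    (e : F ≃* Matrix.ProjectiveSpecialLinearGroup (Fin 2) K) :
    ProjectiveCover K (SL(2, K)) F where
  ofSL := MonoidHom.id _
  toGL := SpecialLinearGroup.toGL
  proj := e.symm.toMonoidHom.comp (QuotientGroup.mk' _)
  toGL_injective := SpecialLinearGroup.toGL_injective
  toGL_ofSL _ := rfl
  proj_surjective := e.symm.surjective.comp (QuotientGroup.mk'_surjective _)
  proj_eq_one_iff g := by simp [SpecialLinearGroup.toGL_mem_center_iff]

/-- `PGL₂` is covered by `GL₂`. -/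
def ProjectiveCover.pgl {F : Type*} [Group F]
    (e : F ≃* ProjectiveGeneralLinearGroup (Fin 2) K) :
    ProjectiveCover K (GL (Fin 2) K) F where
  ofSL := SpecialLinearGroup.toGL
  toGL := MonoidHom.id _
  proj := e.symm.toMonoidHom.comp (QuotientGroup.mk' _)
  toGL_injective := Function.injective_id
  toGL_ofSL _ := rfl
  proj_surjective := e.symm.surjective.comp (QuotientGroup.mk'_surjective _)
  proj_eq_one_iff g := by simp

namespace ProjectiveCover

variable {G F : Type*} [Group G] [Group F] (c : ProjectiveCover K G F)

/-- The root subgroup of `F`, parametrized by `K`. -/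
def root : Multiplicative K →* F := c.proj.comp (c.ofSL.comp unipotent)

theorem root_injective : Function.Injective c.root := by
  rw [injective_iff_map_eq_one]
  intro x hx
  change c.proj _ = 1 at hx
  rw [proj_eq_one_iff, MonoidHom.comp_apply, toGL_ofSL, mem_center_iff] at hx
  exact hx.2.1

variable [Finite K]

include c in
theorem finite : Finite F :=
  have := Finite.of_injective _ c.toGL_injective
  Finite.of_surjective _ c.proj_surjective

omit [Finite K] in
theorem card_root_range : Nat.card c.root.range = Nat.card K :=
  (Nat.card_congr (MonoidHom.ofInjective c.root_injective).toEquiv).symm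

variable {p : ℕ} [Fact p.Prime] {k : ℕ}

/-- The order of `F` divides that of `GL₂`, namely `q * (q ^ 2 - 1) * (q - 1)`, whose cofactor of
`q` is prime to `p`. -/
theorem not_dvd_index_root_range (hk : k ≠ 0) (hK : Nat.card K = p ^ k) :
    ¬ p ∣ c.root.range.index := by
  have := Fintype.ofFinite K
  have hF : Nat.card F ∣ Nat.card (GL (Fin 2) K) :=
    (Subgroup.card_dvd_of_surjective _ c.proj_surjective).trans
      (Subgroup.card_dvd_of_injective _ c.toGL_injective)
  rw [← Subgroup.card_mul_index c.root.range, card_root_range, card_GL_field,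
    ← Nat.card_eq_fintype_card] at hF
  set q := Nat.card K with hq
  have hq1 : 1 ≤ q := Nat.card_pos
  have hprod : ∏ i : Fin 2, (q ^ 2 - q ^ (i : ℕ)) = q * ((q ^ 2 - 1) * (q - 1)) := by
    rw [Fin.prod_univ_two]
    simp only [Fin.val_zero, Fin.val_one, pow_zero, pow_one]
    rw [show q ^ 2 - q = q * (q - 1) by rw [Nat.mul_sub, pow_two, mul_one]]
    ring
  rw [hprod] at hF
  have hF' := Nat.dvd_of_mul_dvd_mul_left hq1 hF
  intro hp
  have hpp : p.Prime := Fact.out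
  have hpq : p ∣ q := hK ▸ dvd_pow_self p hk
  rcases hpp.dvd_mul.1 (hp.trans hF') with h | h
  · have := (Nat.dvd_sub_iff_right (Nat.one_le_pow _ _ hq1) (dvd_pow hpq two_ne_zero)).1 h
    exact hpp.one_lt.ne' (Nat.dvd_one.1 this)
  · have := (Nat.dvd_sub_iff_right hq1 hpq).1 h
    exact hpp.one_lt.ne' (Nat.dvd_one.1 this)

/-- The Sylow subgroup of unitriangular elements. -/
def sylow (hk : k ≠ 0) (hK : Nat.card K = p ^ k) : Sylow p F :=
  (IsPGroup.of_card (c.card_root_range.trans hK)).toSylow (c.not_dvd_index_root_range hk hK)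

variable (hk : k ≠ 0) (hK : Nat.card K = p ^ k)

theorem coe_sylow : (c.sylow hk hK : Subgroup F) = c.root.range := rfl

/-- The normalizer of the root group is the Borel subgroup, so this Sylow subgroup plays the role of
the point `∞`. -/
theorem proj_smul_sylow_iff (g : G) :
    c.proj g • c.sylow hk hK = c.sylow hk hK ↔ c.toGL g 1 0 = 0 := by
  constructor
  · intro h
    have h1 : c.proj g * c.root (.ofAdd 1) * (c.proj g)⁻¹ ∈ c.root.range := by
      rw [← c.coe_sylow hk hK, ← h]
      exact ⟨_, ⟨.ofAdd 1, rfl⟩, rfl⟩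
    obtain ⟨y, hy⟩ := h1
    have h2 : c.proj (g * c.ofSL (unipotent (.ofAdd 1)) * g⁻¹ * (c.ofSL (unipotent y))⁻¹) = 1 := by
      rw [map_mul, map_inv, mul_inv_eq_one, map_mul, map_mul, map_inv]
      exact hy.symm
    rw [proj_eq_one_iff, GeneralLinearGroup.mem_center_iff_val_mem_range_scalar] at h2
    obtain ⟨r, hr⟩ := h2
    have h3 : (c.toGL g : Matrix (Fin 2) (Fin 2) K) * (unipotent (.ofAdd 1)).val =
        scalar (Fin 2) r * (unipotent y).val * (c.toGL g).val := by
      rw [hr, ← SpecialLinearGroup.coe_GL_coe_matrix, ← SpecialLinearGroup.coe_GL_coe_matrix,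
        ← c.toGL_ofSL, ← c.toGL_ofSL, ← Units.val_mul, ← Units.val_mul, ← Units.val_mul, ← map_mul,
        ← map_mul, ← map_mul, inv_mul_cancel_right, inv_mul_cancel_right]
    -- With bottom row `(c, d)` of `g`, these read `c = r * c` and `c + d = r * d`, so `c ≠ 0` would
    -- force `r = 1` and then `c = 0`.
    have e0 := congrFun (congrFun h3 1) 0
    have e1 := congrFun (congrFun h3 1) 1
    simp [Matrix.mul_apply, Fin.sum_univ_two, coe_unipotent] at e0 e1
    by_contra hc
    have hr1 : r = 1 := mul_right_cancel₀ hc (e0.symm.trans (one_mul _).symm)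
    rw [hr1] at e1
    exact hc (by linear_combination e1)
  · intro h
    have hle : ((c.proj g • c.sylow hk hK : Sylow p F) : Subgroup F) ≤ c.sylow hk hK := by
      rintro _ ⟨_, ⟨x, rfl⟩, rfl⟩
      change c.proj g * c.root x * (c.proj g)⁻¹ ∈ c.root.range
      obtain ⟨y, hy⟩ : ∃ y : Multiplicative K,
          g * c.ofSL (unipotent x) = c.ofSL (unipotent y) * g := by
        have hd : c.toGL g 1 1 ≠ 0 := by
          have := (c.toGL g).det.ne_zero
          rw [GeneralLinearGroup.val_det_apply, det_fin_two, h] at this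
          simp at this
          exact this.2
        refine ⟨.ofAdd (c.toGL g 0 0 * x.toAdd / c.toGL g 1 1), c.toGL_injective ?_⟩
        rw [map_mul, map_mul, toGL_ofSL, toGL_ofSL]
        ext i j
        fin_cases i <;> fin_cases j <;>
          simp [Matrix.mul_apply, Fin.sum_univ_two, SpecialLinearGroup.coe_GL_coe_matrix,
            coe_unipotent, h, hd, add_comm]
      refine ⟨y, ?_⟩
      rw [eq_mul_inv_iff_mul_eq]
      change c.proj _ * _ = _ * c.proj _
      rw [← map_mul, ← map_mul]
      exact congrArg c.proj hy.symm
    exact ((c.proj g • c.sylow hk hK).is_maximal' (c.sylow hk hK).isPGroup' hle |> Sylow.ext).symm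

/-- The Sylow subgroup of lower unitriangular elements. -/
def opposite : Sylow p F := c.proj (c.ofSL weyl) • c.sylow hk hK

theorem opposite_ne : c.opposite hk hK ≠ c.sylow hk hK := by
  rw [opposite, Ne, proj_smul_sylow_iff, toGL_ofSL]
  simp [SpecialLinearGroup.coe_GL_coe_matrix, coe_weyl]

theorem proj_smul_opposite_iff (g : G) :
    c.proj g • c.opposite hk hK = c.opposite hk hK ↔ c.toGL g 0 1 = 0 := by
  rw [opposite, smul_smul, ← inv_smul_eq_iff, smul_smul, ← map_mul, ← map_inv, ← map_mul,
    proj_smul_sylow_iff, map_mul, map_mul, map_inv, toGL_ofSL, ← map_inv]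
  simp [Matrix.mul_apply, Fin.sum_univ_two,
    SpecialLinearGroup.coe_GL_coe_matrix, coe_weyl, inv_def,
    adjugate_fin_two_of]

theorem exists_smul_opposite (R : Sylow p F) (hR : R ≠ c.sylow hk hK) :
    ∃ u ∈ c.sylow hk hK, u • c.opposite hk hK = R := by
  have := c.finite
  obtain ⟨f, rfl⟩ := MulAction.exists_smul_eq F (c.sylow hk hK) R
  obtain ⟨g, rfl⟩ := c.proj_surjective f
  rw [Ne, proj_smul_sylow_iff] at hR
  -- `g` sends `∞` to this ratio, and translation by it sends `0`, the point of the opposite Sylow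
  -- subgroup, to the same place.
  set x : Multiplicative K := .ofAdd (c.toGL g 0 0 / c.toGL g 1 0) with hx
  refine ⟨c.root x, ⟨x, rfl⟩, ?_⟩
  change c.proj _ • c.proj _ • _ = _
  symm
  rw [← inv_smul_eq_iff, ← inv_smul_eq_iff, smul_smul, smul_smul, ← map_inv c.proj, ← map_inv c.proj,
    ← map_mul, ← map_mul, proj_smul_sylow_iff, map_mul, map_mul, MonoidHom.comp_apply,
    ← map_inv c.ofSL, ← map_inv c.ofSL, toGL_ofSL, toGL_ofSL]
  simp [Matrix.mul_apply, Fin.sum_univ_two,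
    SpecialLinearGroup.coe_GL_coe_matrix, coe_weyl, coe_unipotent, hx, inv_def,
    adjugate_fin_two_of]
  field_simp
  ring

include c hk hK in
theorem eq_one_of_smul_sylow (f : F) (hf : ∀ R : Sylow p F, f • R = R) : f = 1 := by
  obtain ⟨g, rfl⟩ := c.proj_surjective f
  have h1 := (c.proj_smul_sylow_iff hk hK g).1 (hf _)
  have h2 := (c.proj_smul_opposite_iff hk hK g).1 (hf _)
  -- This is the point `1`; a matrix fixing `∞`, `0` and `1` is scalar.
  have h3 := hf (c.root (.ofAdd 1) • c.opposite hk hK)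
  rw [root, MonoidHom.comp_apply, smul_smul, ← inv_smul_eq_iff, smul_smul, ← map_mul, ← map_inv,
    ← map_mul, proj_smul_opposite_iff, map_mul, map_mul, MonoidHom.comp_apply, map_inv, toGL_ofSL,
    ← map_inv] at h3
  simp [Matrix.mul_apply, Fin.sum_univ_two,
    SpecialLinearGroup.coe_GL_coe_matrix, coe_unipotent, h1, h2, inv_def,
    adjugate_fin_two_of] at h3
  rw [proj_eq_one_iff, mem_center_iff]
  refine ⟨h1, h2, ?_⟩
  linear_combination h3

theorem exists_torus_generator : ∃ t : F, (orderOf t).Coprime p ∧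
    ∀ f : F, f ∈ Subgroup.zpowers t ↔
      f • c.sylow hk hK = c.sylow hk hK ∧ f • c.opposite hk hK = c.opposite hk hK := by
  -- The ratio of its entries determines a diagonal matrix up to scalars, so the torus of `F` is a
  -- subgroup of the cyclic group `Kˣ`, for `PSL₂` and `PGL₂` alike.
  obtain ⟨⟨_, x, ⟨g, hg⟩, rfl⟩, hgen⟩ := IsCyclic.exists_generator
    (α := (c.toGL.range.comap diag).map (divMonoidHom : Kˣ × Kˣ →* Kˣ))
  refine ⟨c.proj g, ?_, fun f ↦ ⟨?_, ?_⟩⟩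
  · have h1 : c.proj g ^ (Nat.card K - 1) = 1 := by
      have hx : x ^ (Nat.card K - 1) = 1 := by
        rw [← Nat.card_units K]
        exact Prod.ext (pow_card_eq_one' (x := x.1)) (pow_card_eq_one' (x := x.2))
      rw [← map_pow, proj_eq_one_iff, map_pow, hg, ← map_pow, hx, map_one]
      exact one_mem _
    have hq1 : 1 ≤ Nat.card K := Nat.card_pos
    refine Nat.Coprime.coprime_dvd_left (orderOf_dvd_of_pow_eq_one h1) ?_
    rw [Nat.coprime_comm, (Fact.out : p.Prime).coprime_iff_not_dvd]
    intro h
    have := (Nat.dvd_sub_iff_right hq1 (hK ▸ dvd_pow_self p hk)).1 h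
    exact (Fact.out : p.Prime).one_lt.ne' (Nat.dvd_one.1 this)
  · rintro ⟨n, rfl⟩
    change c.proj g ^ n • _ = _ ∧ c.proj g ^ n • _ = _
    rw [← map_zpow, proj_smul_sylow_iff, proj_smul_opposite_iff, map_zpow, hg, ← map_zpow]
    simp [diag]
  · rintro ⟨h1, h2⟩
    obtain ⟨g', rfl⟩ := c.proj_surjective f
    rw [proj_smul_sylow_iff] at h1
    rw [proj_smul_opposite_iff] at h2
    obtain ⟨y, hy⟩ := exists_eq_diag _ h1 h2
    obtain ⟨n, hn⟩ := hgen ⟨_, y, ⟨g', hy⟩, rfl⟩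
    replace hn : (x.1 / x.2) ^ n = y.1 / y.2 := congrArg Subtype.val hn
    refine ⟨n, ?_⟩
    change c.proj g ^ n = _
    rw [← map_zpow, ← mul_inv_eq_one, ← map_inv, ← map_mul, proj_eq_one_iff, map_mul, map_inv,
      map_zpow, hg, hy, ← map_inv, ← map_zpow, ← map_mul]
    apply diag_mem_center
    rw [div_zpow] at hn
    change x.1 ^ n * y.1⁻¹ / (x.2 ^ n * y.2⁻¹) = 1
    rw [← div_eq_mul_inv, ← div_eq_mul_inv, div_div_div_comm, hn, div_self']

theorem sylow_le_closure (t : F)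
    (ht : ∀ f : F, f ∈ Subgroup.zpowers t ↔
      f • c.sylow hk hK = c.sylow hk hK ∧ f • c.opposite hk hK = c.opposite hk hK) :
    (c.sylow hk hK : Subgroup F) ≤ Subgroup.closure
      (Set.range fun n : ℤ ↦ t ^ n * c.root (.ofAdd 1) * (t ^ n)⁻¹) := by
  set N := Subgroup.closure (Set.range fun n : ℤ ↦ t ^ n * c.root (.ofAdd 1) * (t ^ n)⁻¹)
  have hsq (a : K) : c.root (.ofAdd (a ^ 2)) ∈ N := by
    by_cases ha : a = 0
    · subst ha
      rw [zero_pow two_ne_zero, ofAdd_zero, map_one]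
      exact one_mem _
    · obtain ⟨n, hn⟩ := (ht (c.proj (c.ofSL (torus (Units.mk0 a ha))))).2 <| by
        rw [proj_smul_sylow_iff, proj_smul_opposite_iff, toGL_ofSL]
        simp [SpecialLinearGroup.coe_GL_coe_matrix, coe_torus]
      refine Subgroup.subset_closure ⟨n, ?_⟩
      change t ^ n = _ at hn
      change t ^ n * _ * (t ^ n)⁻¹ = _
      rw [hn, mul_inv_eq_iff_eq_mul]
      change _ * c.proj _ = c.proj _ * _
      rw [← map_mul, ← map_mul]
      congr 1
      change _ * c.ofSL _ = c.ofSL _ * _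
      rw [← map_mul, ← map_mul]
      exact congrArg c.ofSL (torus_mul_unipotent_one _)
  rintro _ ⟨x, rfl⟩
  obtain ⟨a, b, hab⟩ := FiniteField.exists_sq_sub_sq x.toAdd
  have : x = .ofAdd (a ^ 2) / .ofAdd (b ^ 2) := by
    rw [← ofAdd_sub, ← hab]
    rfl
  rw [this, map_div]
  exact div_mem (hsq a) (hsq b)

include c hk hK in
theorem center_eq_bot : Subgroup.center F = ⊥ := by
  have := c.finite
  rw [eq_bot_iff]
  intro f hf
  refine c.eq_one_of_smul_sylow hk hK f fun R ↦ ?_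
  rw [Sylow.smul_eq_iff_mem_normalizer]
  exact Subgroup.center_le_normalizer _ hf

include c hk hK in
theorem card_range_conjAct_le {H C : Type*} [Group H] [Group C] [IsCyclic C]
    (E : GroupExtension F H C)
    (hE : ∀ l : F, (orderOf l).Coprime p →
      ∀ a : H, a ∈ Subgroup.normalizer (Subgroup.zpowers (E.inl l) : Set H) →
        Commute (a ^ 2) (E.inl l)) (P : Sylow p F) :
    Nat.card E.conjAct.range ≤ 2 * Nat.card P ^ 3 := by
  have := c.finite
  obtain ⟨t, htp, ht⟩ := c.exists_torus_generator hk hK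
  rw [Nat.card_congr (P.equiv (c.sylow hk hK)).toEquiv]
  refine card_subgroup_mulAut_le _ _ (c.opposite_ne hk hK) (c.exists_smul_opposite hk hK)
    (c.eq_one_of_smul_sylow hk hK) t ht (c.root (.ofAdd 1)) ⟨_, rfl⟩ ?_
    (c.sylow_le_closure hk hK t ht) _ E.exists_generator_mod_conj (E.conjAct_sq_apply t (hE t htp))
  rw [Ne, map_eq_one_iff _ c.root_injective, ofAdd_eq_one]
  exact one_ne_zero

end ProjectiveCover

end TwoByTwo

end LinearGroups

/-! ### The main theorem -/

theorem corollary6p7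
    (p : ℕ) [Fact p.Prime] (k : ℕ) (hk : k ≠ 0)
    {F H Hbar : Type*} [Group F] [Group H] [Group Hbar]
    (hF : Nonempty (F ≃* Matrix.ProjectiveSpecialLinearGroup (Fin 2) (GaloisField p k)) ∨
      Nonempty (F ≃* ProjectiveGeneralLinearGroup (Fin 2) (GaloisField p k)))
    [Finite Hbar] [IsCyclic Hbar] (hHbar : (Nat.card Hbar).Coprime p)
    (E : GroupExtension F H Hbar)
    (hE : ∀ l : F, (orderOf l).Coprime p →
      ∀ a : H, a ∈ Subgroup.normalizer (Subgroup.zpowers (E.inl l) : Set H) →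
        Commute (a ^ 2) (E.inl l))
    (P : Sylow p F) :
    ∃ A : Subgroup H, IsCyclic A ∧ (Nat.card A).Coprime p ∧
      A.FiniteIndex ∧ A.index ≤ 2 * Nat.card P ^ 3 ∧
      ∀ φ ∈ autPreserving E.inl.range, A.map φ.toMonoidHom = A := by
  have hK : Nat.card (GaloisField p k) = p ^ k := GaloisField.card p k hk
  obtain ⟨hfin, hcenter, hcard⟩ : Finite F ∧ Subgroup.center F = ⊥ ∧
      Nat.card E.conjAct.range ≤ 2 * Nat.card P ^ 3 := by
    rcases hF with ⟨⟨e⟩⟩ | ⟨⟨e⟩⟩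
    · have c := TwoByTwo.ProjectiveCover.psl e
      exact ⟨c.finite, c.center_eq_bot hk hK, c.card_range_conjAct_le hk hK E hE P⟩
    · have c := TwoByTwo.ProjectiveCover.pgl e
      exact ⟨c.finite, c.center_eq_bot hk hK, c.card_range_conjAct_le hk hK E hE P⟩
  have hinj := E.injective_rightHom_ker_conjAct hcenter
  rw [← Subgroup.index_ker] at hcard
  refine ⟨E.conjAct.ker, isCyclic_of_injective _ hinj, ?_, ⟨?_⟩, hcard, fun φ hφ ↦ ?_⟩
  · exact hHbar.coprime_dvd_left (Subgroup.card_dvd_of_injective _ hinj)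
  · rw [Subgroup.index_ker]
    exact Nat.card_pos.ne'
  · rw [E.ker_conjAct, E.map_centralizer_range_inl φ hφ]
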